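/- Let $n \ge 0$ and let $f : \{0,1\}^n \to \{0,1\}$ be a Boolean function. Let $\deg_{1/3}(f)$ be the minimum degree of a real polynomial $p$ in $n$ variables with $|f(x) - p(x)| \le \frac13$ for all $x \in \{0,1\}^n$. Let the block sensitivity $bs(f)$ be the largest $t$ for which there are an input $x \in \{0,1\}^n$ and pairwise disjoint sets $R_1, \dots, R_t \subseteq \{1, \dots, n\}$ such that $f(x) \ne f(x^{(R_i)})$ for every $i$, where $x^{(R)}$ is $x$ with the bits indexed by $R$ flipped. Then $$\deg_{1/3}(f)^2 \;\ge\; \sqrt{\tfrac{6}{101}}\; bs(f), \qquad \text{where } \sqrt{\tfrac{6}{101}} \approx 0.24.$$ -/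

import Mathlib

namespace BooleanComplexity

/-- A Boolean function of `n` variables, that is, a map `{0, 1}^n → {0, 1}`. -/
abbrev BoolFun (n : ℕ) : Type := (Fin n → Bool) → Bool

/-- The real number `0` or `1` that a bit stands for. -/
def bitVal (b : Bool) : ℝ := if b then 1 else 0

/-- The real polynomial `p` is an `ε`-approximation of `f`:
`|f(x) - p(x)| ≤ ε` at every point `x` of the cube `{0, 1}^n`. -/
def Approximates {n : ℕ} (ε : ℝ) (f : BoolFun n) (p : MvPolynomial (Fin n) ℝ) : Prop :=
  ∀ x : Fin n → Bool, |bitVal (f x) - MvPolynomial.eval (fun i => bitVal (x i)) p| ≤ ε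

/-- The approximate degree `deg_ε(f)`: the minimum (total) degree among the real polynomials
that `ε`-approximate `f`. -/
noncomputable def approxDeg {n : ℕ} (ε : ℝ) (f : BoolFun n) : ℕ :=
  sInf {d : ℕ | ∃ p : MvPolynomial (Fin n) ℝ, Approximates ε f p ∧ p.totalDegree = d}

/-- The input `x^(R)`: the bits of `x` whose index lies in the block `R` are flipped. -/
def flip {n : ℕ} (x : Fin n → Bool) (R : Finset (Fin n)) : Fin n → Bool :=
  fun i => if i ∈ R then !(x i) else x i

/-- `B` is a family of pairwise disjoint blocks, each of which changes the value of `f` when it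
is flipped in `x`. Such blocks are automatically nonempty, so disjoint ones are distinct. -/
def IsSensitiveFamily {n : ℕ} (f : BoolFun n) (x : Fin n → Bool)
    (B : Finset (Finset (Fin n))) : Prop :=
  (∀ R ∈ B, ∀ S ∈ B, R ≠ S → Disjoint R S) ∧ ∀ R ∈ B, f x ≠ f (flip x R)

instance {n : ℕ} (f : BoolFun n) (x : Fin n → Bool) :
    DecidablePred (IsSensitiveFamily f x) :=
  fun B => inferInstanceAs (Decidable
    ((∀ R ∈ B, ∀ S ∈ B, R ≠ S → Disjoint R S) ∧ ∀ R ∈ B, f x ≠ f (flip x R)))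

/-- The local block sensitivity `bs(f, x)`: the largest number of pairwise disjoint blocks each
of which changes the value of `f` when it is flipped in `x`. -/
def localBlockSensitivity {n : ℕ} (f : BoolFun n) (x : Fin n → Bool) : ℕ :=
  (Finset.univ.filter (IsSensitiveFamily f x)).sup Finset.card

/-- The block sensitivity `bs(f)`: the maximum of `bs(f, x)` over all inputs `x`. -/
def blockSensitivity {n : ℕ} (f : BoolFun n) : ℕ :=
  Finset.univ.sup (localBlockSensitivity f)

/-- Every Boolean function is represented exactly by a real polynomial; hence the minimum that
defines `approxDeg ε f` is over a nonempty set whenever `0 ≤ ε`. -/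
theorem exists_approximates {n : ℕ} {ε : ℝ} (hε : 0 ≤ ε) (f : BoolFun n) :
    ∃ p : MvPolynomial (Fin n) ℝ, Approximates ε f p := by
  refine ⟨∑ y : Fin n → Bool, MvPolynomial.C (bitVal (f y)) *
    ∏ i, (if y i then MvPolynomial.X i else 1 - MvPolynomial.X i), fun x => ?_⟩
  have key : ∀ y : Fin n → Bool,
      (∏ i, MvPolynomial.eval (fun i => bitVal (x i))
        (if y i then MvPolynomial.X i else 1 - MvPolynomial.X i : MvPolynomial (Fin n) ℝ))
        = if y = x then 1 else 0 := by
    intro y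
    split_ifs with h
    · subst h
      refine Finset.prod_eq_one fun i _ => ?_
      cases hy : y i <;> simp [bitVal, hy]
    · obtain ⟨i, hi⟩ := Function.ne_iff.mp h
      refine Finset.prod_eq_zero (Finset.mem_univ i) ?_
      cases hy : y i <;> cases hx : x i <;> simp_all [bitVal]
  simp only [map_sum, map_mul, map_prod, MvPolynomial.eval_C, key]
  simpa using hε

/-- The minimum that defines `approxDeg` is attained. -/
theorem exists_totalDegree_eq_approxDeg {n : ℕ} {ε : ℝ} (hε : 0 ≤ ε) (f : BoolFun n) :
    ∃ p : MvPolynomial (Fin n) ℝ, Approximates ε f p ∧ p.totalDegree = approxDeg ε f := by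
  obtain ⟨p, hp⟩ := exists_approximates hε f
  exact Nat.sInf_mem
    (s := {d : ℕ | ∃ p : MvPolynomial (Fin n) ℝ, Approximates ε f p ∧ p.totalDegree = d})
    ⟨p.totalDegree, p, hp, rfl⟩

end BooleanComplexity

/-!
Let `b = bs(f)`, attained at `x` by a family `B` of blocks, and let `p` approximate `f` with degree
`d`. Averaging `p` over the inputs obtained by flipping `k` of the blocks gives a univariate
polynomial in `k` of degree at most `d` (`symmetrizesTo_eval_flip`). After an affine normalization it
becomes a polynomial `h` with `|h(k)| ≤ 1` at the integers `0, …, b`, and `h(0) ≤ -1/5`,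
`h(1) ≥ 1/5`, since every single block flips the value
(`exists_polynomial_of_isSensitiveFamily`). It remains to bound `d` from below for such an `h`
(`sqrt_mul_le_sq_of_natDegree_le`).

Suppose that `q = d² / b` is less than `√(6/101)`. Then `b ≥ 5`, and
`-(4 h(0) - 5 h(1) + h(5)) ≥ 4/5`, because `h` rises by `2/5` in the first step but is at most `1`
at `5`. This contradicts an upper bound on the same functional that comes from two facts.

* `h` is not much larger than `1` between the integers. At an interior maximum of `|h|` the
  derivative vanishes, and the second derivative is controlled by the extremality of the Chebyshev
  polynomial `T` at an endpoint, applied to the longer of the two pieces into which a point cuts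
  the interval. Hence `|h| ≤ M` on `[0, b]` with `M ≤ 1 + (4/3) q² M`, so `M ≤ 101/93`
  (`exists_bound_of_grid`).
* Written in terms of the values of `h` at the `d + 1` extremal points of the Chebyshev polynomial
  on `[0, b]`, the functional `4 h(0) - 5 h(1) + h(5)` has coefficients of alternating sign, because
  all the extremal points but `0` lie to the right of `5` (`node_one_le`). So it is at most `M` times
  its value at the Chebyshev polynomial (`threePoint_le`), and that value is at most `2/3` by Taylor
  expansion at the endpoint (`threePoint_T_le`).

Since `(101/93) * (2/3) < 4/5`, this is a contradiction.
-/

namespace BooleanComplexity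

section Symmetrization

/-! ### Symmetrization -/

open Finset

/-- The function `F` on the subsets of `B` symmetrizes to a univariate real polynomial of degree at
most `d`: its average over the `k`-element subsets of `B` is the value of that polynomial at `k`. -/
def SymmetrizesTo {β : Type*} (B : Finset β) (d : ℕ) (F : Finset β → ℝ) : Prop :=
  ∃ P : Polynomial ℝ, P.natDegree ≤ d ∧ ∀ k ≤ #B,
    ∑ S ∈ B.powersetCard k, F S = (Nat.choose #B k : ℝ) * P.eval (k : ℝ)

namespace SymmetrizesTo

variable {β : Type*} {B : Finset β} {d : ℕ}

theorem zero : SymmetrizesTo B d fun _ => 0 := ⟨0, by simp, by simp⟩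

theorem add {F G : Finset β → ℝ} (hF : SymmetrizesTo B d F) (hG : SymmetrizesTo B d G) :
    SymmetrizesTo B d fun S => F S + G S := by
  obtain ⟨P, hP, hPk⟩ := hF
  obtain ⟨Q, hQ, hQk⟩ := hG
  refine ⟨P + Q, Polynomial.natDegree_add_le_of_degree_le hP hQ, fun k hk => ?_⟩
  rw [sum_add_distrib, hPk k hk, hQk k hk, Polynomial.eval_add]
  ring

theorem const_mul {F : Finset β → ℝ} (c : ℝ) (hF : SymmetrizesTo B d F) :
    SymmetrizesTo B d fun S => c * F S := by
  obtain ⟨P, hP, hPk⟩ := hF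
  refine ⟨Polynomial.C c * P, (Polynomial.natDegree_C_mul_le c P).trans hP, fun k hk => ?_⟩
  rw [← mul_sum, hPk k hk, Polynomial.eval_mul, Polynomial.eval_C]
  ring

theorem sum {ι : Type*} (s : Finset ι) {F : ι → Finset β → ℝ}
    (hF : ∀ i ∈ s, SymmetrizesTo B d (F i)) : SymmetrizesTo B d fun S => ∑ i ∈ s, F i S := by
  classical
  induction s using Finset.induction_on with
  | empty => simpa using zero
  | insert i s hi ih =>
    simp only [sum_insert hi]
    exact (hF i (mem_insert_self i s)).add (ih fun j hj => hF j (mem_insert_of_mem hj))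

theorem congr {F G : Finset β → ℝ} (hF : SymmetrizesTo B d F) (h : ∀ S ⊆ B, F S = G S) :
    SymmetrizesTo B d G := by
  obtain ⟨P, hP, hPk⟩ := hF
  refine ⟨P, hP, fun k hk => ?_⟩
  rw [← hPk k hk]
  exact sum_congr rfl fun S hS => (h S (mem_powersetCard.mp hS).1).symm

/-- The average over the `k`-subsets of the indicator of `U ⊆ S` is
`(k choose #U) / (#B choose #U)`, a polynomial in `k` of degree `#U`. -/
theorem indicator_subset [DecidableEq β] (U : Finset β) (hU : #U ≤ d) :
    SymmetrizesTo B d fun S => if U ⊆ S then 1 else 0 := by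
  by_cases hUB : U ⊆ B
  swap
  · refine zero.congr fun S hS => ?_
    rw [if_neg fun h => hUB (h.trans hS)]
  have hcard := card_le_card hUB
  have hpos : (0 : ℝ) < Nat.choose #B #U := by exact_mod_cast Nat.choose_pos hcard
  refine ⟨Polynomial.C ((Nat.factorial #U : ℝ) * Nat.choose #B #U)⁻¹ * descPochhammer ℝ #U,
    (Polynomial.natDegree_C_mul_le _ _).trans ?_, fun k hk => ?_⟩
  · rw [descPochhammer_natDegree]; exact hU
  have heval : (descPochhammer ℝ #U).eval (k : ℝ) = (Nat.factorial #U : ℝ) * Nat.choose k #U := by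
    rw [descPochhammer_eval_eq_descFactorial, Nat.descFactorial_eq_factorial_mul_choose]
    push_cast; ring
  have hfac : (0 : ℝ) < Nat.factorial #U := by exact_mod_cast Nat.factorial_pos _
  rw [Polynomial.eval_mul, Polynomial.eval_C, heval, sum_boole]
  rcases le_or_gt #U k with hUk | hUk
  · rw [card_filter_powersetCard_subset U B k hUB hUk]
    have h : (Nat.choose #B k : ℝ) * Nat.choose k #U =
        Nat.choose #B #U * Nat.choose (#B - #U) (k - #U) := by
      exact_mod_cast Nat.choose_mul hUk
    field_simp
    linarith
  · rw [Nat.choose_eq_zero_of_lt hUk, filter_false_of_mem fun S hS h => ?_]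
    · simp
    · have := card_le_card h
      rw [(mem_powersetCard.mp hS).2] at this
      omega

/-- A product of affine functions of the bits `r i ∈ S` symmetrizes to a polynomial whose degree is
at most the number of factors. -/
theorem prod_affine [DecidableEq β] {ι : Type*} (s : Finset ι) (hs : #s ≤ d)
    (r : ι → β) (u v : ι → ℝ) :
    SymmetrizesTo B d fun S => ∏ i ∈ s, ((u i * if r i ∈ S then 1 else 0) + v i) := by
  classical
  have key : ∀ S : Finset β, ∏ i ∈ s, ((u i * if r i ∈ S then 1 else 0) + v i) =
      ∑ t ∈ s.powerset, ((∏ i ∈ t, u i) * ∏ i ∈ s \ t, v i) *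
        if t.image r ⊆ S then 1 else 0 := by
    intro S
    rw [prod_add]
    refine sum_congr rfl fun t _ => ?_
    have : (∏ i ∈ t, if r i ∈ S then (1 : ℝ) else 0) = if t.image r ⊆ S then 1 else 0 := by
      rw [prod_ite_zero, prod_const_one]
      simp only [image_subset_iff]
    rw [prod_mul_distrib, this]
    ring
  simp only [key]
  refine sum _ fun t ht => const_mul _ (indicator_subset _ ?_)
  exact card_image_le.trans ((card_le_card (mem_powerset.mp ht)).trans hs)

end SymmetrizesTo

theorem bitVal_pow (b : Bool) {m : ℕ} (hm : m ≠ 0) : bitVal b ^ m = bitVal b := by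
  cases b <;> simp [bitVal, hm]

theorem bitVal_flip {n : ℕ} (x : Fin n → Bool) (R : Finset (Fin n)) (i : Fin n) :
    bitVal (flip x R i) =
      ((1 - 2 * bitVal (x i)) * if i ∈ R then 1 else 0) + bitVal (x i) := by
  unfold flip
  split_ifs <;> cases x i <;> simp [bitVal]
  norm_num

/-- Flipping the union of a subfamily of disjoint blocks and averaging over the subfamilies of
given size turns a multivariate polynomial into a univariate one of no larger degree. -/
theorem symmetrizesTo_eval_flip {n : ℕ} (p : MvPolynomial (Fin n) ℝ) (x : Fin n → Bool)
    (B : Finset (Finset (Fin n))) (hdisj : ∀ R ∈ B, ∀ S ∈ B, R ≠ S → Disjoint R S)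
    (hne : ∅ ∉ B) :
    SymmetrizesTo B p.totalDegree fun S =>
      MvPolynomial.eval (fun i => bitVal (flip x (S.biUnion id) i)) p := by
  -- The block of `i`, or `∅` (which is not in `B`) if no block contains `i`.
  let r : Fin n → Finset (Fin n) := fun i => (B.filter (i ∈ ·)).biUnion id
  have hr : ∀ S ⊆ B, ∀ i, i ∈ S.biUnion id ↔ r i ∈ S := by
    intro S hS i
    have hri : ∀ R ∈ B, i ∈ R → r i = R := by
      intro R hR hi
      have : B.filter (i ∈ ·) = {R} := by
        ext R'
        simp only [mem_filter, mem_singleton]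
        refine ⟨fun h => ?_, fun h => h ▸ ⟨hR, hi⟩⟩
        by_contra hcon
        exact disjoint_left.mp (hdisj R' h.1 R hR hcon) h.2 hi
      simp [r, this]
    constructor
    · intro h
      obtain ⟨R, hR, hi⟩ := mem_biUnion.mp h
      rw [hri R (hS hR) hi]
      exact hR
    · intro h
      have hne' : r i ≠ ∅ := fun h0 => hne (hS (h0 ▸ h))
      obtain ⟨j, hj⟩ := nonempty_iff_ne_empty.mpr hne'
      obtain ⟨R, hR, -⟩ := mem_biUnion.mp hj
      obtain ⟨hRB, hiR⟩ := mem_filter.mp hR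
      rw [hri R hRB hiR] at h
      exact mem_biUnion.mpr ⟨R, h, hiR⟩
  refine (SymmetrizesTo.sum p.support fun m hm => (SymmetrizesTo.prod_affine (B := B) m.support
    (d := p.totalDegree) ?_ r (fun i => 1 - 2 * bitVal (x i)) fun i => bitVal (x i)).const_mul
      (p.coeff m)).congr fun S hS => ?_
  · refine le_trans ?_ (MvPolynomial.le_totalDegree hm)
    rw [card_eq_sum_ones, Finsupp.sum]
    exact sum_le_sum fun i hi => Nat.one_le_iff_ne_zero.mpr (Finsupp.mem_support_iff.mp hi)
  · rw [MvPolynomial.eval_eq]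
    refine sum_congr rfl fun m _ => congrArg _ (prod_congr rfl fun i hi => ?_)
    rw [bitVal_pow _ (Finsupp.mem_support_iff.mp hi), bitVal_flip]
    simp only [hr S hS i]

theorem flip_empty {n : ℕ} (x : Fin n → Bool) : flip x ∅ = x := by
  ext i; simp [flip]

/-- Symmetrizing an approximating polynomial around a sensitive family of `#B` blocks. The affine
normalization sends the range `[-1/3, 4/3]` of the approximation to `[-1, 1]`, with the sign chosen
so that `f x` becomes the lower value. -/
theorem exists_polynomial_of_isSensitiveFamily {n : ℕ} {f : BoolFun n}
    {p : MvPolynomial (Fin n) ℝ} (hp : Approximates (1 / 3) f p) {x : Fin n → Bool}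
    {B : Finset (Finset (Fin n))} (hB : IsSensitiveFamily f x B) (hpos : 1 ≤ #B) :
    ∃ h : Polynomial ℝ, h.natDegree ≤ p.totalDegree ∧ (∀ k : ℕ, k ≤ #B → |h.eval (k : ℝ)| ≤ 1) ∧
      h.eval 0 ≤ -(1 / 5) ∧ 1 / 5 ≤ h.eval 1 := by
  have hne : ∅ ∉ B := fun h0 => hB.2 ∅ h0 (by rw [flip_empty])
  -- `g` is the approximation after the normalization.
  obtain ⟨s, hs⟩ : ∃ s : ℝ, s = 1 - 2 * bitVal (f x) := ⟨_, rfl⟩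
  let g : Finset (Finset (Fin n)) → ℝ := fun S => (3 / 5) * s *
    (2 * MvPolynomial.eval (fun i => bitVal (flip x (S.biUnion id) i)) p + (-1) *
      if (∅ : Finset (Finset (Fin n))) ⊆ S then 1 else 0)
  have hg : SymmetrizesTo B p.totalDegree g :=
    (((symmetrizesTo_eval_flip p x B hB.1 hne).const_mul 2).add
      ((SymmetrizesTo.indicator_subset ∅ (by simp)).const_mul (-1))).const_mul _
  have habs : ∀ S, |g S| ≤ 1 := by
    intro S
    have h := abs_le.mp (hp (flip x (S.biUnion id)))
    rw [abs_le]
    simp only [g, empty_subset, if_true, hs]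
    cases f x <;> cases hy : f (flip x (S.biUnion id)) <;> rw [hy] at h <;>
      simp [bitVal] at h ⊢ <;> constructor <;> linarith [h.1, h.2]
  obtain ⟨h, hdeg, hk⟩ := hg
  refine ⟨h, hdeg, fun k hkB => ?_, ?_, ?_⟩
  · have hc : (0 : ℝ) < Nat.choose #B k := by exact_mod_cast Nat.choose_pos hkB
    have h1 : |∑ S ∈ B.powersetCard k, g S| ≤ Nat.choose #B k := by
      refine (abs_sum_le_sum_abs _ _).trans ((sum_le_sum fun S _ => habs S).trans ?_)
      simp
    rw [hk k hkB, abs_mul, abs_of_pos hc] at h1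
    exact le_of_mul_le_mul_left (by linarith) hc
  · have h0 := hk 0 (Nat.zero_le _)
    have h := abs_le.mp (hp x)
    simp only [powersetCard_zero, sum_singleton, Nat.choose_zero_right, Nat.cast_one, one_mul,
      Nat.cast_zero, g, biUnion_empty, flip_empty, empty_subset, if_true] at h0
    rw [← h0, hs]
    cases hy : f x <;> rw [hy] at h <;> simp [bitVal] at h ⊢ <;> linarith [h.1, h.2]
  · have h1 := hk 1 hpos
    have hc : (0 : ℝ) < #B := by exact_mod_cast hpos
    have h2 : (#B : ℝ) * (1 / 5) ≤ ∑ S ∈ B.powersetCard 1, g S := by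
      rw [powersetCard_one, sum_map, ← nsmul_eq_mul]
      refine card_nsmul_le_sum _ _ _ fun R hR => ?_
      have h := abs_le.mp (hp (flip x R))
      have hsens := hB.2 R hR
      simp only [g, Function.Embedding.coeFn_mk, singleton_biUnion, id, empty_subset, if_true, hs]
      cases hy : f x <;> cases hz : f (flip x R) <;> rw [hy, hz] at hsens <;> rw [hz] at h <;>
        simp [bitVal] at hsens h ⊢ <;> linarith [h.1, h.2]
    rw [h1, Nat.choose_one_right, Nat.cast_one] at h2
    exact le_of_mul_le_mul_left h2 hc

end Symmetrization

section Univariate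

open Polynomial Polynomial.Chebyshev Finset

/-! ### Derivatives of bounded polynomials -/

theorem abs_derivative_derivative_eval_one_le {d : ℕ} {Q : ℝ[X]} (hd : Q.natDegree ≤ d) {M : ℝ}
    (hM : 0 < M) (hQ : ∀ t ∈ Set.Icc (-1 : ℝ) 1, |Q.eval t| ≤ M) :
    |(derivative^[2] Q).eval 1| ≤ M * (derivative^[2] (T ℝ d)).eval 1 := by
  have key : ∀ c : ℝ, |c| = M⁻¹ →
      c * (derivative^[2] Q).eval 1 ≤ (derivative^[2] (T ℝ d)).eval 1 := by
    intro c hc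
    have h := eval_iterate_derivative_le_of_forall_abs_le_one (n := d) (P := C c * Q) (k := 2)
      (le_refl 1) (degree_le_of_natDegree_le ((natDegree_C_mul_le c Q).trans hd)) fun t ht => by
        rw [eval_mul, eval_C, abs_mul, hc, inv_mul_le_iff₀ hM, mul_one]
        exact hQ t ht
    rwa [iterate_derivative_C_mul, eval_mul, eval_C] at h
  have h1 := key M⁻¹ (abs_of_pos (inv_pos.mpr hM))
  have h2 := key (-M⁻¹) (by rw [abs_neg, abs_of_pos (inv_pos.mpr hM)])
  rw [inv_mul_le_iff₀ hM] at h1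
  rw [neg_mul, ← mul_neg, inv_mul_le_iff₀ hM] at h2
  exact abs_le.mpr ⟨by linarith, h1⟩

/-- A weak form of V. A. Markov's inequality: the second derivative exceeds that of the Chebyshev
polynomial at `1` by a factor of at most `4`. The point `y` is an endpoint of a subinterval of
`[-1, 1]` of at least half the length, and at an endpoint the Chebyshev polynomial is extremal. -/
theorem abs_derivative_derivative_eval_le {d : ℕ} {Q : ℝ[X]} (hd : Q.natDegree ≤ d) {M : ℝ}
    (hM : 0 < M) (hQ : ∀ t ∈ Set.Icc (-1 : ℝ) 1, |Q.eval t| ≤ M) {y : ℝ}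
    (hy : y ∈ Set.Icc (-1 : ℝ) 1) :
    |(derivative^[2] Q).eval y| ≤ 4 * (M * (derivative^[2] (T ℝ d)).eval 1) := by
  -- `t ↦ a * t + c` maps `[-1, 1]` into itself and `1` to `y`, with `|a| ≥ 1 / 2`.
  obtain ⟨a, c, hac, ha, hmap⟩ : ∃ a c : ℝ, a + c = y ∧ 1 / 4 ≤ a ^ 2 ∧
      ∀ t ∈ Set.Icc (-1 : ℝ) 1, a * t + c ∈ Set.Icc (-1 : ℝ) 1 := by
    obtain ⟨hy1, hy2⟩ := hy
    rcases le_total 0 y with h | h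
    · exact ⟨(1 + y) / 2, (y - 1) / 2, by ring, by nlinarith, fun t ⟨h1, h2⟩ =>
        ⟨by nlinarith, by nlinarith⟩⟩
    · exact ⟨(y - 1) / 2, (y + 1) / 2, by ring, by nlinarith, fun t ⟨h1, h2⟩ =>
        ⟨by nlinarith, by nlinarith⟩⟩
  have hlin : (C a * X + C c : ℝ[X]).natDegree ≤ 1 := natDegree_linear_le
  have h := abs_derivative_derivative_eval_one_le (d := d) (Q := Q.comp (C a * X + C c))
    (natDegree_comp_le.trans ((Nat.mul_le_mul hd hlin).trans_eq (mul_one d))) hM fun t ht => by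
      simpa using hQ _ (hmap t ht)
  have h2 : (derivative^[2] (Q.comp (C a * X + C c))).eval 1 =
      a ^ 2 * (derivative^[2] Q).eval y := by
    simp [Function.iterate_succ, derivative_comp, hac]
    ring
  rw [h2, abs_mul, abs_of_nonneg (sq_nonneg a)] at h
  nlinarith [abs_nonneg ((derivative^[2] Q).eval y)]

theorem abs_eval_sub_eval_le {Q : ℝ[X]} {K x y : ℝ}
    (hK : ∀ z ∈ Set.uIcc x y, |(derivative Q).eval z| ≤ K) :
    |Q.eval y - Q.eval x| ≤ K * |y - x| := by
  have := Convex.norm_image_sub_le_of_norm_deriv_le (f := fun z => Q.eval z) (s := Set.uIcc x y)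
    (C := K) (fun z _ => Q.differentiableAt) (fun z hz => by
      rw [Polynomial.deriv]; exact hK z hz) (convex_uIcc x y) Set.left_mem_uIcc Set.right_mem_uIcc
  simpa [Real.norm_eq_abs] using this

/-- Near a critical point a polynomial varies quadratically. -/
theorem abs_eval_sub_eval_le_sq {Q : ℝ[X]} {K x y : ℝ} (hx : (derivative Q).eval x = 0)
    (hK : ∀ z ∈ Set.uIcc x y, |(derivative^[2] Q).eval z| ≤ K) :
    |Q.eval y - Q.eval x| ≤ K * |y - x| ^ 2 := by
  have hK0 : 0 ≤ K := (abs_nonneg _).trans (hK x Set.left_mem_uIcc)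
  have h : ∀ z ∈ Set.uIcc x y, |(derivative Q).eval z| ≤ K * |y - x| := by
    intro z hz
    have := abs_eval_sub_eval_le (Q := derivative Q) (K := K) (x := x) (y := z) fun w hw =>
      hK w (Set.uIcc_subset_uIcc Set.left_mem_uIcc hz hw)
    rw [hx, sub_zero] at this
    exact this.trans (mul_le_mul_of_nonneg_left (Set.abs_sub_left_of_mem_uIcc hz) hK0)
  have := abs_eval_sub_eval_le h
  rwa [mul_assoc, ← sq] at this

/-! ### Polynomials bounded on a grid -/

/-- The point `1 - 2 * k / b` of `[-1, 1]` that corresponds to the point `k` of `[0, b]`. -/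
noncomputable def gridPoint (b k : ℕ) : ℝ := 1 - 2 * k / b

/-- A polynomial bounded by `1` at the grid points exceeds `1` in between only slightly: at an
interior maximum the derivative vanishes, and some grid point lies within distance `1 / b`. -/
theorem exists_bound_of_grid {d b : ℕ} (hb : 0 < b) {Q : ℝ[X]} (hd : Q.natDegree ≤ d)
    (hQ : ∀ k ≤ b, |Q.eval (gridPoint b k)| ≤ 1) :
    ∃ M : ℝ, 0 ≤ M ∧ (∀ t ∈ Set.Icc (-1 : ℝ) 1, |Q.eval t| ≤ M) ∧
      M ≤ 1 + 4 * (M * (derivative^[2] (T ℝ d)).eval 1) * (1 / b) ^ 2 := by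
  have hbR : (0 : ℝ) < b := by exact_mod_cast hb
  obtain ⟨x, hx, hmax⟩ := isCompact_Icc.exists_isMaxOn (s := Set.Icc (-1 : ℝ) 1)
    ⟨0, by norm_num⟩ (f := fun t => |Q.eval t|) Q.continuous.abs.continuousOn
  have hmax' : ∀ t ∈ Set.Icc (-1 : ℝ) 1, |Q.eval t| ≤ |Q.eval x| := fun t ht => hmax ht
  refine ⟨|Q.eval x|, abs_nonneg _, hmax', ?_⟩
  have hT0 : 0 ≤ (derivative^[2] (T ℝ d)).eval 1 :=
    (abs_nonneg _).trans (abs_iterate_derivative_T_real_le d 2 (x := 0) (by norm_num))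
  have hnn : 0 ≤ 4 * (|Q.eval x| * (derivative^[2] (T ℝ d)).eval 1) * (1 / b : ℝ) ^ 2 := by
    positivity
  rcases le_or_gt |Q.eval x| 1 with hle | hgt
  · linarith
  have hg0 : gridPoint b 0 = 1 := by simp [gridPoint]
  have hgb : gridPoint b b = -1 := by
    rw [gridPoint, mul_div_assoc, div_self hbR.ne']; norm_num
  have hx1 : x ≠ 1 := by
    rintro rfl
    have := hQ 0 (Nat.zero_le _)
    rw [hg0] at this
    linarith
  have hx2 : x ≠ -1 := by
    rintro rfl
    have := hQ b le_rfl
    rw [hgb] at this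
    linarith
  have hxo : x ∈ Set.Ioo (-1 : ℝ) 1 :=
    ⟨lt_of_le_of_ne hx.1 hx2.symm, lt_of_le_of_ne hx.2 hx1⟩
  -- `Q ^ 2`, unlike `|Q|`, is differentiable, and its derivative `2 * Q * Q'` vanishes at `x`.
  have hcrit : (derivative Q).eval x = 0 := by
    have hloc : IsLocalMax (fun t => (Q ^ 2).eval t) x := by
      filter_upwards [Ioo_mem_nhds hxo.1 hxo.2] with t ht
      have := hmax' t (Set.Ioo_subset_Icc_self ht)
      simpa using sq_le_sq.mpr this
    have h := hloc.deriv_eq_zero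
    rw [Polynomial.deriv] at h
    have hne : Q.eval x ≠ 0 := by
      intro h0; rw [h0, abs_zero] at hgt; linarith
    simpa [derivative_pow, hne] using h
  -- the index of the nearest grid point
  have hu0 : 0 ≤ b * (1 - x) / 2 := by
    have := hx.2
    have : 0 ≤ 1 - x := by linarith
    positivity
  have hub : b * (1 - x) / 2 ≤ b := by
    have := hx.1
    nlinarith
  obtain ⟨k, hkb, hk⟩ : ∃ k : ℕ, k ≤ b ∧ |b * (1 - x) / 2 - k| ≤ 1 / 2 := by
    refine ⟨⌊b * (1 - x) / 2 + 1 / 2⌋₊, ?_, ?_⟩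
    · have : ⌊b * (1 - x) / 2 + 1 / 2⌋₊ < b + 1 := by
        rw [Nat.floor_lt (by positivity)]
        push_cast
        linarith
      omega
    · have h1 := Nat.floor_le (a := b * (1 - x) / 2 + 1 / 2) (by positivity)
      have h2 := Nat.lt_floor_add_one (b * (1 - x) / 2 + 1 / 2)
      rw [abs_le]
      constructor <;> linarith
  have hdist : |gridPoint b k - x| ≤ 1 / b := by
    have : gridPoint b k - x = (2 / b) * (b * (1 - x) / 2 - k) := by
      rw [gridPoint]; field_simp; ring
    rw [this, abs_mul, abs_of_pos (by positivity)]
    calc 2 / (b : ℝ) * |b * (1 - x) / 2 - k| ≤ 2 / b * (1 / 2) := by gcongr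
      _ = 1 / b := by ring
  have hgk : gridPoint b k ∈ Set.Icc (-1 : ℝ) 1 := by
    have hkR : (k : ℝ) ≤ b := by exact_mod_cast hkb
    have h1 : 2 * (k : ℝ) / b ≤ 2 := by rw [div_le_iff₀ hbR]; linarith
    have h2 : 0 ≤ 2 * (k : ℝ) / b := by positivity
    constructor <;> rw [gridPoint] <;> linarith
  have h := abs_eval_sub_eval_le_sq (y := gridPoint b k) hcrit fun z hz =>
    abs_derivative_derivative_eval_le hd (by linarith) hmax'
      (Set.uIcc_subset_Icc hx hgk hz)
  have hK : 0 ≤ 4 * (|Q.eval x| * (derivative^[2] (T ℝ d)).eval 1) := by positivity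
  have h3 : |Q.eval (gridPoint b k) - Q.eval x| ≤
      4 * (|Q.eval x| * (derivative^[2] (T ℝ d)).eval 1) * (1 / b) ^ 2 :=
    h.trans (mul_le_mul_of_nonneg_left (by gcongr) hK)
  have h4 := abs_sub_abs_le_abs_sub (Q.eval x) (Q.eval (gridPoint b k))
  rw [abs_sub_comm] at h4
  linarith [hQ k hkb]

/-! ### A three-point functional extremal for Chebyshev polynomials -/

/-- Beyond all its roots a product of monic linear factors is nonnegative, increasing and convex;
convexity is tested at the three points `w`, `w + 4 * e` and `w + 5 * e`. -/
theorem prod_sub_convex {ι : Type*} (s : Finset ι) (v : ι → ℝ) {w e : ℝ} (he : 0 ≤ e)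
    (hv : ∀ j ∈ s, v j ≤ w) :
    0 ≤ ∏ j ∈ s, (w - v j) ∧ ∏ j ∈ s, (w - v j) ≤ ∏ j ∈ s, (w + 4 * e - v j) ∧
      ∏ j ∈ s, (w + 4 * e - v j) ≤ ∏ j ∈ s, (w + 5 * e - v j) ∧
      5 * ∏ j ∈ s, (w + 4 * e - v j) ≤ 4 * ∏ j ∈ s, (w + 5 * e - v j) + ∏ j ∈ s, (w - v j) := by
  classical
  induction s using Finset.induction_on with
  | empty => norm_num
  | insert i s hi ih =>
    obtain ⟨h0, h1, h2, h3⟩ := ih fun j hj => hv j (mem_insert_of_mem hj)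
    have hvi := hv i (mem_insert_self i s)
    simp only [prod_insert hi]
    generalize ∏ j ∈ s, (w - v j) = p at *
    generalize ∏ j ∈ s, (w + 4 * e - v j) = q at *
    generalize ∏ j ∈ s, (w + 5 * e - v j) = r at *
    obtain ⟨z, hz⟩ : ∃ z, w = z + v i := ⟨w - v i, by ring⟩
    have hz0 : 0 ≤ z := by linarith
    rw [show w - v i = z by linarith, show w + 4 * e - v i = z + 4 * e by linarith,
      show w + 5 * e - v i = z + 5 * e by linarith]
    clear hz hvi
    refine ⟨mul_nonneg hz0 h0, ?_, ?_, ?_⟩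
    · nlinarith
    · nlinarith
    · nlinarith

/-- The values at three points to the right of all Chebyshev nodes except `node d 0 = 1`, combined
with the coefficients of a second divided difference, are extremal for the Chebyshev polynomial. -/
theorem threePoint_le {d : ℕ} {Q : ℝ[X]} (hd : Q.natDegree ≤ d) {M : ℝ} (hM : 0 < M)
    (hQ : ∀ t ∈ Set.Icc (-1 : ℝ) 1, |Q.eval t| ≤ M) {w e : ℝ} (he : 0 ≤ e) (hwe : w + 5 * e = 1)
    (hw : node d 1 ≤ w) :
    -(4 * Q.eval 1 - 5 * Q.eval (w + 4 * e) + Q.eval w) ≤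
      M * (4 * (T ℝ d).eval 1 - 5 * (T ℝ d).eval (w + 4 * e) + (T ℝ d).eval w) := by
  -- the numerators of the Lagrange basis polynomials at the Chebyshev nodes
  let N : ℕ → ℝ → ℝ := fun i t => ∏ j ∈ (range (d + 1)).erase i, (t - node d j)
  let c : ℕ → ℝ := fun i => (∏ j ∈ (range (d + 1)).erase i, (node d i - node d j))⁻¹ *
    (4 * N i 1 - 5 * N i (w + 4 * e) + N i w)
  have hrep : ∀ P : ℝ[X], P.natDegree ≤ d →
      sumNodes d c P = 4 * P.eval 1 - 5 * P.eval (w + 4 * e) + P.eval w := by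
    intro P hP
    have hlt : P.degree < #(range (d + 1)) := by
      rw [card_range]
      exact (degree_le_of_natDegree_le hP).trans_lt (by exact_mod_cast Nat.lt_succ_self d)
    have heval : ∀ t, P.eval t = ∑ i ∈ range (d + 1),
        P.eval (node d i) / (∏ j ∈ (range (d + 1)).erase i, (node d i - node d j)) * N i t := by
      intro t
      conv_lhs => rw [Lagrange.eq_interpolate (strictAntiOn_node d).injOn hlt,
        Lagrange.interpolate_eq_sum]
      simp [eval_finsetSum, eval_prod, N]
    rw [heval 1, heval (w + 4 * e), heval w, sumNodes, mul_sum, mul_sum, ← sum_sub_distrib,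
      ← sum_add_distrib, ← Nat.range_succ_eq_Iic]
    refine sum_congr rfl fun i _ => ?_
    simp only [c]
    ring
  have hnode : ∀ j ≤ d, j ≠ 0 → node d j ≤ w := by
    intro j hj hj0
    refine le_trans ?_ hw
    exact (strictAntiOn_node d).antitoneOn (by simp; omega) (by simp; omega) (by omega)
  have hsign : ∀ i ≤ d, 0 ≤ (-1) ^ i * c i := by
    intro i hi
    have h1 : 0 < (-1) ^ i * (∏ j ∈ (range (d + 1)).erase i, (node d i - node d j))⁻¹ := by
      have := inv_pos_of_pos (zero_lt_prod_node_sub_node hi)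
      rwa [mul_inv, ← inv_pow, inv_neg_one] at this
    simp only [c]
    rw [← mul_assoc]
    refine mul_nonneg h1.le ?_
    rcases eq_or_ne i 0 with rfl | hi0
    · -- all the roots of `N 0` are at most `w`, so that `N 0` is convex from `w` on
      have := (prod_sub_convex ((range (d + 1)).erase 0) (node d) he fun j hj => hnode j
        (Nat.lt_succ_iff.mp (mem_range.mp (mem_of_mem_erase hj))) (ne_of_mem_erase hj)).2.2.2
      rw [hwe] at this
      simp only [N]
      linarith
    · -- `N i` has the root `1`, and the other factors are increasing from `w` on
      have h0 : 0 ∈ (range (d + 1)).erase i := by simp [hi0.symm]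
      obtain ⟨h2, h3, -, -⟩ := prod_sub_convex (((range (d + 1)).erase i).erase 0) (node d) he
        fun j hj => hnode j (Nat.lt_succ_iff.mp
          (mem_range.mp (mem_of_mem_erase (mem_of_mem_erase hj)))) (ne_of_mem_erase hj)
      simp only [N]
      rw [← mul_prod_erase _ _ h0, ← mul_prod_erase _ _ h0, ← mul_prod_erase _ _ h0, node_eq_one]
      have e1 : w + 4 * e - 1 = -e := by linarith
      have e2 : w - 1 = -(5 * e) := by linarith
      rw [e1, e2]
      nlinarith [mul_le_mul_of_nonneg_left h3 he]
  have h := sumNodes_le_sumNodes_T hsign (P := C (-M⁻¹) * Q) fun t ht => by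
    rw [eval_mul, eval_C, abs_mul, abs_neg, abs_of_pos (inv_pos.mpr hM), inv_mul_le_iff₀ hM,
      mul_one]
    exact hQ t ht
  rw [hrep _ ((natDegree_C_mul_le _ Q).trans hd), hrep _ (natDegree_T ℝ d).le] at h
  simp only [eval_mul, eval_C] at h
  rw [← inv_mul_le_iff₀ hM]
  linarith

/-! ### Chebyshev polynomials near the endpoint -/

theorem iteratedDeriv_eval (p : ℝ[X]) (k : ℕ) :
    iteratedDeriv k (fun t => p.eval t) = fun t => (derivative^[k] p).eval t := by
  induction k with
  | zero => simp
  | succ k ih =>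
    rw [iteratedDeriv_succ, ih]
    ext t
    rw [Polynomial.deriv, Function.iterate_succ_apply']

theorem iterate_derivative_T_values (d : ℕ) :
    (derivative^[1] (T ℝ d)).eval 1 = (d : ℝ) ^ 2 ∧
    (derivative^[2] (T ℝ d)).eval 1 = (d : ℝ) ^ 2 * (d ^ 2 - 1) / 3 ∧
    (derivative^[3] (T ℝ d)).eval 1 = (d : ℝ) ^ 2 * (d ^ 2 - 1) * (d ^ 2 - 4) / 15 ∧
    (derivative^[4] (T ℝ d)).eval 1 =
      (d : ℝ) ^ 2 * (d ^ 2 - 1) * (d ^ 2 - 4) * (d ^ 2 - 9) / 105 := by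
  refine ⟨?_, ?_, ?_, ?_⟩ <;> rw [iterate_derivative_T_eval_one_eq_div] <;>
    simp [prod_range_succ]

/-- Taylor expansion of the Chebyshev polynomial at `1` to third order; the fourth derivative is
largest in absolute value at `1`. -/
theorem abs_eval_T_sub_taylor_le (d : ℕ) {y : ℝ} (hy0 : 0 < y) (hy2 : y ≤ 2) :
    |(T ℝ d).eval (1 - y) - (1 - (d : ℝ) ^ 2 * y + (d : ℝ) ^ 2 * (d ^ 2 - 1) / 6 * y ^ 2 -
      (d : ℝ) ^ 2 * (d ^ 2 - 1) * (d ^ 2 - 4) / 90 * y ^ 3)| ≤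
      (d : ℝ) ^ 2 * (d ^ 2 - 1) * (d ^ 2 - 4) * (d ^ 2 - 9) / 2520 * y ^ 4 := by
  obtain ⟨t1, t2, t3, t4⟩ := iterate_derivative_T_values d
  have hne : (1 : ℝ) ≠ 1 - y := by linarith
  have hcd : ∀ m : ℕ, ContDiff ℝ m fun t => (T ℝ d).eval t := fun m => by
    simpa [coe_aeval_eq_eval] using (T ℝ (d : ℤ)).contDiff_aeval (𝕜 := ℝ) m
  obtain ⟨x, hx, h⟩ := taylor_mean_remainder_lagrange_iteratedDeriv (n := 3)
    (f := fun t => (T ℝ d).eval t) hne (hcd 4).contDiffOn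
  have hxI : |x| ≤ 1 := by
    rw [Set.uIoo_of_ge (by linarith)] at hx
    rw [abs_le]
    constructor <;> linarith [hx.1, hx.2]
  have hu : ∀ k, iteratedDerivWithin k (fun t => (T ℝ d).eval t) (Set.uIcc 1 (1 - y)) 1 =
      (derivative^[k] (T ℝ d)).eval 1 := by
    intro k
    rw [iteratedDerivWithin_eq_iteratedDeriv (uniqueDiffOn_uIcc hne)
      (hcd k).contDiffAt Set.left_mem_uIcc, iteratedDeriv_eval]
  have hb := abs_iterate_derivative_T_real_le d 4 hxI
  rw [taylor_within_apply] at h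
  simp only [hu, sum_range_succ, range_zero, sum_empty, t1, t2, t3, iteratedDeriv_eval] at h
  rw [t4] at hb
  simp [Nat.factorial] at h
  have hsub : (T ℝ d).eval (1 - y) - (1 - (d : ℝ) ^ 2 * y + (d : ℝ) ^ 2 * (d ^ 2 - 1) / 6 * y ^ 2 -
      (d : ℝ) ^ 2 * (d ^ 2 - 1) * (d ^ 2 - 4) / 90 * y ^ 3) =
      (derivative^[4] (T ℝ d)).eval x * (y ^ 4 / 24) := by
    simp [Function.iterate_succ]
    linear_combination h
  rw [hsub, abs_mul, abs_of_nonneg (a := y ^ 4 / 24) (by positivity)]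
  calc _ ≤ _ * (y ^ 4 / 24) := mul_le_mul_of_nonneg_right hb (by positivity)
    _ = _ := by ring

theorem node_one_le {b d : ℕ} (hd : 1 ≤ d) (hb : 5 ≤ b) (h : 101 * (d : ℝ) ^ 4 < 6 * b ^ 2) :
    node d 1 ≤ 1 - 10 / b := by
  have hbR : (5 : ℝ) ≤ b := by exact_mod_cast hb
  have hb0 : (0 : ℝ) < b := by linarith
  rcases eq_or_lt_of_le hd with rfl | hd2
  · have : (10 : ℝ) / b ≤ 2 := by rw [div_le_iff₀ hb0]; linarith
    rw [node_eq_neg_one one_ne_zero]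
    linarith
  have hdR : (2 : ℝ) ≤ d := by exact_mod_cast hd2
  have hd0 : (0 : ℝ) < d := by linarith
  -- `1 - cos (π / d) = 2 * sin (π / (2 * d)) ^ 2`, with `1.5 / d` as a lower bound for
  -- `u = π / (2 * d)` and `0.8` as an upper bound
  obtain ⟨u, hu⟩ : ∃ u, u = Real.pi / (2 * d) := ⟨_, rfl⟩
  have hu1 : 3 / 2 ≤ u * d := by
    rw [hu]; field_simp; linarith [Real.pi_gt_three]
  have hu0 : 0 < u := by rw [hu]; positivity
  have hu2 : u ≤ 4 / 5 := by
    rw [hu, div_le_iff₀ (by positivity)]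
    nlinarith [Real.pi_lt_d2]
  have hcos : node d 1 = 1 - 2 * Real.sin u ^ 2 := by
    rw [node, show ((1 : ℕ) : ℝ) * Real.pi / d = 2 * u by rw [hu]; push_cast; field_simp,
      Real.cos_two_mul, Real.cos_sq']
    ring
  have hsin : 4 / 3 ≤ Real.sin u * d := by
    have h1 := (Real.sin_gt_sub_cube hu0).le
    have h2 : u * (1 - (4 / 5) ^ 2 / 6) ≤ Real.sin u := by nlinarith [mul_pos hu0 hu0]
    have h3 := mul_le_mul_of_nonneg_right h2 hd0.le
    nlinarith
  have hsq : 16 / 9 ≤ Real.sin u ^ 2 * (d : ℝ) ^ 2 := by nlinarith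
  have hdb : 4 * (d : ℝ) ^ 2 < b := by
    refine lt_of_pow_lt_pow_left₀ 2 hb0.le ?_
    nlinarith
  have hfin : 10 / (b : ℝ) ≤ 2 * Real.sin u ^ 2 := by
    rw [div_le_iff₀ hb0]
    nlinarith [mul_le_mul_of_nonneg_left hdb.le (sq_nonneg (Real.sin u))]
  rw [hcos]
  linarith

/-- Here `q = d ^ 2 / b` and `t = 1 / d ^ 2`; the maximum is attained for `t = 0` and the largest
admissible `q`, and its value is about `0.651`. -/
theorem threePoint_chebyshev_bound {q t : ℝ} (hq0 : 0 ≤ q) (hq : q ^ 2 ≤ 6 / 101) (ht0 : 0 ≤ t) :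
    (1 - t) * q ^ 2 * (40 / 3 - 32 / 3 * q * (1 - 4 * t) + 4 * q ^ 2) ≤ 2 / 3 := by
  have hq1 : q ≤ 61 / 250 := by
    by_contra hcon
    nlinarith
  have h1 : (1 - t) * (40 / 3 - 32 / 3 * q * (1 - 4 * t) + 4 * q ^ 2) ≤
      40 / 3 - 32 / 3 * q + 4 * q ^ 2 := by
    have : 0 ≤ 40 / 3 - 160 / 3 * q := by linarith
    nlinarith [mul_nonneg ht0 this, mul_nonneg (mul_nonneg ht0 ht0) hq0,
      mul_nonneg ht0 (sq_nonneg q)]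
  have h2 : 40 / 3 * q ^ 2 - 32 / 3 * q ^ 3 ≤
      40 / 3 * (61 / 250) ^ 2 - 32 / 3 * (61 / 250 : ℝ) ^ 3 := by
    have h3 : 0 ≤ 40 / 3 * (61 / 250 + q) -
        32 / 3 * ((61 / 250) ^ 2 + 61 / 250 * q + q ^ 2) := by nlinarith
    nlinarith [mul_nonneg (sub_nonneg.mpr hq1) h3]
  have h4 : q ^ 4 ≤ (6 / 101) ^ 2 := by
    rw [show q ^ 4 = (q ^ 2) ^ 2 by ring]
    gcongr
  have h5 := mul_le_mul_of_nonneg_left h1 (sq_nonneg q)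
  nlinarith

theorem threePoint_T_le {b d : ℕ} (hd : 1 ≤ d) (hb : 5 ≤ b)
    (h : 101 * (d : ℝ) ^ 4 < 6 * b ^ 2) :
    4 * (T ℝ d).eval 1 - 5 * (T ℝ d).eval (1 - 2 / (b : ℝ)) + (T ℝ d).eval (1 - 10 / (b : ℝ)) ≤
      2 / 3 := by
  have hbR : (5 : ℝ) ≤ b := by exact_mod_cast hb
  have hb0 : (0 : ℝ) < b := by linarith
  have hdR : (1 : ℝ) ≤ d := by exact_mod_cast hd
  have hD1 : (1 : ℝ) ≤ (d : ℝ) ^ 2 := by nlinarith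
  have h2 := (abs_le.mp (abs_eval_T_sub_taylor_le d (y := 2 / b) (by positivity)
    (by rw [div_le_iff₀ hb0]; linarith))).1
  have h10 := (abs_le.mp (abs_eval_T_sub_taylor_le d (y := 10 / b) (by positivity)
    (by rw [div_le_iff₀ hb0]; linarith))).2
  have hfour : (d : ℝ) ^ 2 * (d ^ 2 - 1) * (d ^ 2 - 4) * (d ^ 2 - 9) ≤
      (d : ℝ) ^ 2 * (d ^ 2 - 1) * (d ^ 2) ^ 2 := by
    rcases eq_or_lt_of_le hd with rfl | hd2
    · norm_num
    · have hdR2 : (2 : ℝ) ≤ d := by exact_mod_cast hd2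
      have : ((d : ℝ) ^ 2 - 4) * (d ^ 2 - 9) ≤ (d ^ 2) ^ 2 := by nlinarith
      rw [mul_assoc]
      exact mul_le_mul_of_nonneg_left this (mul_nonneg (by positivity) (by linarith))
  have hnum := threePoint_chebyshev_bound (q := (d : ℝ) ^ 2 / b) (t := 1 / (d : ℝ) ^ 2)
    (by positivity) (by rw [div_pow, div_le_iff₀ (by positivity)]; nlinarith) (by positivity)
  generalize (d : ℝ) ^ 2 = D at *
  have hD0 : 0 < D := by linarith
  have hT1 : (T ℝ d).eval 1 = 1 := T_eval_one ℝ d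
  have e2 : ∀ c : ℝ, c / (b : ℝ) = c * (1 / b) := fun c => by ring
  have hexp : (1 - 1 / D) * (D / b) ^ 2 *
      (40 / 3 - 32 / 3 * (D / b) * (1 - 4 * (1 / D)) + 4 * (D / b) ^ 2) =
      D * (D - 1) * (40 / 3) * (1 / b) ^ 2 - D * (D - 1) * (D - 4) * (32 / 3) * (1 / b) ^ 3 +
        4 * (D * (D - 1) * D ^ 2) * (1 / b : ℝ) ^ 4 := by
    field_simp
  have hfour' := mul_le_mul_of_nonneg_right hfour (a := (1 / b : ℝ) ^ 4) (by positivity)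
  rw [hexp] at hnum
  rw [hT1]
  rw [e2 2] at h2 ⊢
  rw [e2 10] at h10 ⊢
  generalize (1 / b : ℝ) = r at *
  linarith

/-! ### The univariate degree bound and the theorem -/

/-- The univariate bound: a polynomial of degree at most `d` that is bounded by `1` at the integers
`0, …, b` and increases by `2 / 5` from `0` to `1` has `d ^ 2 ≥ √(6 / 101) * b`. -/
theorem sqrt_mul_le_sq_of_natDegree_le {b d : ℕ} (hb : 1 ≤ b) {h : ℝ[X]} (hd : h.natDegree ≤ d)
    (hk : ∀ k : ℕ, k ≤ b → |h.eval (k : ℝ)| ≤ 1) (h0 : h.eval 0 ≤ -(1 / 5))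
    (h1 : 1 / 5 ≤ h.eval 1) : √(6 / 101) * (b : ℝ) ≤ (d : ℝ) ^ 2 := by
  by_contra! hlt
  have hd1 : 1 ≤ d := by
    by_contra hcon
    have : h.natDegree = 0 := by omega
    rw [eq_C_of_natDegree_eq_zero this] at h0 h1
    simp at h0 h1
    linarith
  have hdR : (1 : ℝ) ≤ d := by exact_mod_cast hd1
  have hdb : 101 * (d : ℝ) ^ 4 < 6 * b ^ 2 := by
    have := pow_lt_pow_left₀ hlt (by positivity) two_ne_zero
    rw [mul_pow, Real.sq_sqrt (by norm_num)] at this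
    nlinarith
  have hb5 : 5 ≤ b := by
    by_contra hcon
    have h4 : (b : ℝ) ≤ 4 := by exact_mod_cast (by omega : b ≤ 4)
    have := one_le_pow₀ hdR (n := 4)
    nlinarith [(Nat.cast_nonneg b : (0 : ℝ) ≤ b)]
  have hb0 : (0 : ℝ) < b := by exact_mod_cast hb
  -- transport from `[0, b]` to `[-1, 1]`, with `0` going to `1`
  let Q : ℝ[X] := h.comp (C (-(b / 2 : ℝ)) * X + C (b / 2 : ℝ))
  have hQd : Q.natDegree ≤ d :=
    natDegree_comp_le.trans ((Nat.mul_le_mul hd natDegree_linear_le).trans_eq (mul_one d))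
  have hQk : ∀ x : ℝ, Q.eval (1 - 2 * x / b) = h.eval x := by
    intro x
    simp only [Q, eval_comp, eval_add, eval_mul, eval_C, eval_X]
    congr 1
    field_simp
    ring
  obtain ⟨M, hM0, hQM, hM⟩ := exists_bound_of_grid (d := d) hb hQd fun k hkb => by
    rw [gridPoint, hQk]; exact hk k hkb
  have hq0 := hQk 0
  have hq1 := hQk 1
  have hq5 := hQk 5
  norm_num at hq0 hq1 hq5
  have hMpos : 0 < M := by
    have := hQM 1 (by norm_num)
    rw [hq0] at this
    linarith [neg_le_abs (h.eval 0)]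
  have hM' : M ≤ 101 / 93 := by
    rw [(iterate_derivative_T_values d).2.1] at hM
    have : (d : ℝ) ^ 2 * (d ^ 2 - 1) / 3 * (1 / b) ^ 2 ≤ 2 / 101 := by
      rw [one_div, inv_pow, ← div_eq_mul_inv, div_le_iff₀ (by positivity)]
      nlinarith [sq_nonneg (d : ℝ)]
    nlinarith [mul_le_mul_of_nonneg_left this hM0]
  have h3 := threePoint_le hQd hMpos hQM (w := 1 - 10 / b) (e := 2 / b) (by positivity) (by ring)
    (node_one_le hd1 hb5 hdb)
  rw [show 1 - 10 / (b : ℝ) + 4 * (2 / b) = 1 - 2 / b by ring, hq0, hq1, hq5] at h3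
  have h5 := (abs_le.mp (hk 5 hb5)).2
  have h4 := mul_le_mul_of_nonneg_left (threePoint_T_le hd1 hb5 hdb) hM0
  push_cast at h5
  linarith

end Univariate

end BooleanComplexity

theorem theorem2 (n : ℕ) (f : BooleanComplexity.BoolFun n) :
    Real.sqrt (6 / 101) * (BooleanComplexity.blockSensitivity f : ℝ) ≤
      (BooleanComplexity.approxDeg (1 / 3) f : ℝ) ^ 2 := by
  obtain ⟨p, hp, hdeg⟩ :=
    BooleanComplexity.exists_totalDegree_eq_approxDeg (ε := 1 / 3) (by norm_num) f
  obtain ⟨x, -, hx⟩ := Finset.exists_mem_eq_sup Finset.univ Finset.univ_nonempty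
    (BooleanComplexity.localBlockSensitivity f)
  have hne : (Finset.univ.filter (BooleanComplexity.IsSensitiveFamily f x)).Nonempty :=
    ⟨∅, by simp [BooleanComplexity.IsSensitiveFamily]⟩
  obtain ⟨B, hB, hcard⟩ := Finset.exists_mem_eq_sup _ hne Finset.card
  have hbs : BooleanComplexity.blockSensitivity f = B.card := by
    rw [BooleanComplexity.blockSensitivity, hx, BooleanComplexity.localBlockSensitivity, hcard]
  rw [hbs, ← hdeg]
  rcases Nat.eq_zero_or_pos B.card with h0 | hpos
  · rw [h0]
    simp only [Nat.cast_zero, mul_zero]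
    positivity
  · obtain ⟨h, hd, hk, h0, h1⟩ := BooleanComplexity.exists_polynomial_of_isSensitiveFamily hp
      (Finset.mem_filter.mp hB).2 hpos
    exact BooleanComplexity.sqrt_mul_le_sq_of_natDegree_le hpos hd hk h0 h1
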